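/- **Setting.** Consider $n$ agents $\dot x_i=A_ix_i+b_iu_i$, with $A_i\in\mathbb R^{m_i\times m_i}$ and $0\ne b_i\in\mathbb R^{m_i}$. They are interconnected by an undirected weighted graph $\mathbb G$ without loops, with weights $a_{ij}=a_{ji}\ge 0$, where $i,j$ are adjacent iff $a_{ij}>0$. Some set of agents is designated as leaders. $\mathbb G$ is *leader-follower connected* if each of its connected components contains at least one leader. A linear system $\dot x=Ax+Bu$ with real matrices is called *$\{\xi_1,\dots,\xi_s\}$-uncontrollable* if $\xi_1^T,\dots,\xi_s^T$ are linearly independent (complex) left eigenvectors of $A$ with $\xi_j^TB=0$ for all $j$, and every left eigenvector $\tilde\xi^T$ of $A$ with $\tilde\xi^TB=0$ satisfies $\tilde\xi\in\mathrm{span}_{\mathbb C}\{\xi_1,\dots,\xi_s\}$ (the list may be empty). A *controllability decomposition* of $(A_i,b_i)$ is given by an index $r_i$ and an invertible real matrix $T_i$ with $$T_iA_iT_i^{-1}=\begin{pmatrix}A_{i,c}&A_{i,12}\\0&A_{i,z}\end{pmatrix},\qquad T_ib_i=e_{r_i},$$ where $A_{i,c}\in\mathbb R^{r_i\times r_i}$,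 $r_i\ge 1$, is a companion matrix $\begin{pmatrix}0&I_{r_i-1}\\ *&*\end{pmatrix}$. Let $\alpha_i^T$ be the $r_i$-th row of $T_iA_iT_i^{-1}$, i.e. the row in which the input acts. For feedback gains $\beta_i\in\mathbb R^{m_i}$ the agents use the protocol $$u_i=-\alpha_i^TT_ix_i+\sum_{j}a_{ij}\,(\beta_j^TT_jx_j-\beta_i^TT_ix_i)+u_{oi},$$ where $u_{oi}\in\mathbb R$ is an external input if $i$ is a leader and $u_{oi}=0$ otherwise. This gives a linear system with state $x=(x_1,\dots,x_n)$ and input $(u_{oi})_{i\text{ leader}}$. The network is called *$\Xi$-uncontrollable* if there are gains $\beta_1,\dots,\beta_n$ for which this linear system is $\Xi$-uncontrollable. For $v\in\mathbb C^{m_i}$, write $v\otimes e_i$ for the stacked vector with $v$ in block $i$ and zeros in the other blocks. **Theorem.** Suppose that for each $i$ the system $(A_i,b_i)$ is $\{\xi_{i1},\dots,\xi_{is_i}\}$-uncontrollable. Then each $(A_i,b_i)$ has a controllability decomposition, and for every choice of controllability decompositions, the network is $\{\xi_{ij}\otimes e_i\mid i=1,\dots,n;\ j=1,\dots,s_i\}$-uncontrollable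 if and only if $\mathbb G$ is leader-follower connected. -/

import Mathlib

namespace HeteroNet

open Matrix

/-! ### Eigenvector-uncontrollable linear systems -/

/-- `ξ` is a (complex) left eigenvector of the real square matrix `A`:
`ξ ≠ 0` and `ξᵀ A = μ ξᵀ` for some `μ : ℂ`. -/
def IsLeftEigenvector {ι : Type*} [Fintype ι] (A : Matrix ι ι ℝ) (ξ : ι → ℂ) : Prop :=
  ξ ≠ 0 ∧ ∃ μ : ℂ, ξ ᵥ* A.map (fun r : ℝ => (r : ℂ)) = μ • ξ

/-- `ξᵀ B = 0`: the vector `ξ` is annihilated by every column of the real matrix `B`. -/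
def IsOrthogonalTo {ι κ : Type*} [Fintype ι] (B : Matrix ι κ ℝ) (ξ : ι → ℂ) : Prop :=
  ξ ᵥ* B.map (fun r : ℝ => (r : ℂ)) = 0

/-- The linear system `ẋ = A x + B u` is `{ξ₁, …, ξₛ}`-uncontrollable: the `ξⱼ` are linearly
independent left eigenvectors of `A` with `ξⱼᵀ B = 0`, and every left eigenvector `θ` of `A`
with `θᵀ B = 0` lies in their span. -/
structure IsEigUncontrollable {ι κ σ : Type*} [Fintype ι]
    (A : Matrix ι ι ℝ) (B : Matrix ι κ ℝ) (ξ : σ → ι → ℂ) : Prop where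
  linearIndependent : LinearIndependent ℂ ξ
  isLeftEigenvector : ∀ j, IsLeftEigenvector A (ξ j)
  isOrthogonalTo : ∀ j, IsOrthogonalTo B (ξ j)
  mem_span : ∀ θ : ι → ℂ, IsLeftEigenvector A θ → IsOrthogonalTo B θ →
    θ ∈ Submodule.span ℂ (Set.range ξ)

/-- A single input vector `b`, seen as a matrix with one column. -/
def inputColumn {ι : Type*} (b : ι → ℝ) : Matrix ι Unit ℝ := Matrix.of fun k _ => b k

/-! ### Interconnection graphs -/

/-- An undirected weighted graph on the agents `0, …, n - 1`: a symmetric nonnegative adjacency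
matrix with zero diagonal. There is an edge between `i` and `j` exactly when `0 < weight i j`. -/
structure WeightedGraph (n : ℕ) where
  weight : Matrix (Fin n) (Fin n) ℝ
  symm : ∀ i j, weight i j = weight j i
  nonneg : ∀ i j, 0 ≤ weight i j
  loopless : ∀ i, weight i i = 0

namespace WeightedGraph

variable {n : ℕ}

/-- The underlying simple graph. -/
def toSimpleGraph (G : WeightedGraph n) : SimpleGraph (Fin n) where
  Adj i j := 0 < G.weight i j
  symm := ⟨fun i j h => by rw [G.symm j i]; exact h⟩
  loopless := ⟨fun i h => by rw [G.loopless i] at h; exact lt_irrefl _ h⟩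

/-- The Laplacian matrix `L = D - A`. -/
def laplacian (G : WeightedGraph n) : Matrix (Fin n) (Fin n) ℝ :=
  Matrix.diagonal (fun i => ∑ j, G.weight i j) - G.weight

/-- Every connected component of the graph contains at least one leader. -/
def IsLeaderFollowerConnected (G : WeightedGraph n) (leaders : Finset (Fin n)) : Prop :=
  ∀ c : G.toSimpleGraph.ConnectedComponent,
    ∃ l ∈ leaders, G.toSimpleGraph.connectedComponentMk l = c

end WeightedGraph

/-! ### Controllability decomposition of one agent -/

/-- A controllability decomposition of the pair `(A, b)`, with the controllable part in companion
form. In the coordinates `T x` the first `last + 1` coordinates are the controllable ones and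
```
T A T⁻¹ = [ A_c  A_12 ; 0  A_z ],    T b = e_last,
```
where every row of `A_c` except its last one is the corresponding row of the shift `[0 I]`.
The last row of `A_c`, the coupling `A_12` and the uncontrollable part `A_z` are arbitrary.
If `(A, b)` is controllable there are no uncontrollable coordinates, and `T A T⁻¹` is the
companion form of `A`. -/
structure ControllabilityForm {m : ℕ} (A : Matrix (Fin m) (Fin m) ℝ) (b : Fin m → ℝ) where
  T : Matrix (Fin m) (Fin m) ℝ
  isUnit_det : IsUnit T.det
  last : Fin m
  input_eq : T *ᵥ b = Pi.single last 1
  shift_eq : ∀ k l : Fin m, k < last → l ≤ last →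
    (T * A * T⁻¹) k l = if (l : ℕ) = k + 1 then 1 else 0
  lower_eq : ∀ k l : Fin m, last < k → l ≤ last → (T * A * T⁻¹) k l = 0

namespace ControllabilityForm

variable {m : ℕ} {A : Matrix (Fin m) (Fin m) ℝ} {b : Fin m → ℝ}

/-- The vector `α` of the local feedback: the row of `T A T⁻¹` in which the input acts. -/
noncomputable def alpha (F : ControllabilityForm A b) : Fin m → ℝ := (F.T * A * F.T⁻¹) F.last

end ControllabilityForm

/-! ### The network -/

section Network

variable {n : ℕ} {m : Fin n → ℕ}

/-- The stacked vector `v ⊗ e_i`: it equals `v` in block `i` and vanishes in the other blocks. -/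
def blockVec {R : Type*} [Zero R] (i : Fin n) (v : Fin (m i) → R) : (Σ k, Fin (m k)) → R :=
  fun p => (Pi.single i v : ∀ k, Fin (m k) → R) p.1 p.2

variable {A : ∀ i, Matrix (Fin (m i)) (Fin (m i)) ℝ} {b : ∀ i, Fin (m i) → ℝ}

/-- The protocol without its external input:
`u_i = - α_iᵀ T_i x_i + ∑_j a_ij (β_jᵀ T_j x_j - β_iᵀ T_i x_i)`. -/
noncomputable def protocol (G : WeightedGraph n) (F : ∀ i, ControllabilityForm (A i) (b i))
    (β : ∀ i, Fin (m i) → ℝ) (x : ∀ i, Fin (m i) → ℝ) (i : Fin n) : ℝ :=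
  - ((F i).alpha ⬝ᵥ ((F i).T *ᵥ x i))
    + ∑ j, G.weight i j * (β j ⬝ᵥ ((F j).T *ᵥ x j) - β i ⬝ᵥ ((F i).T *ᵥ x i))

/-- The system matrix of the closed-loop network, in the stacked state `(x_1, …, x_n)`. Its
`(i, j)` block is `δ_ij (A_i - b_i α_iᵀ T_i) - b_i l_ij β_jᵀ T_j`. -/
noncomputable def networkMatrix (G : WeightedGraph n) (F : ∀ i, ControllabilityForm (A i) (b i))
    (β : ∀ i, Fin (m i) → ℝ) : Matrix (Σ i, Fin (m i)) (Σ i, Fin (m i)) ℝ :=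
  Matrix.blockDiagonal' (fun i => A i - Matrix.vecMulVec (b i) ((F i).alpha ᵥ* (F i).T))
    - Matrix.of fun p q => b p.1 p.2 * G.laplacian p.1 q.1 * (β q.1 ᵥ* (F q.1).T) q.2

/-- The input matrix of the network: one column `b_l ⊗ e_l` for every leader `l`. -/
def networkInput (b : ∀ i, Fin (m i) → ℝ) (leaders : Finset (Fin n)) :
    Matrix (Σ i, Fin (m i)) {l // l ∈ leaders} ℝ :=
  Matrix.of fun p l => blockVec l.1 (b l.1) p

/-- `networkMatrix` is the matrix of `ẋ_i = A_i x_i + b_i u_i` under the protocol. -/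
theorem networkMatrix_mulVec (G : WeightedGraph n) (F : ∀ i, ControllabilityForm (A i) (b i))
    (β : ∀ i, Fin (m i) → ℝ) (x : ∀ i, Fin (m i) → ℝ) (i : Fin n) (k : Fin (m i)) :
    (networkMatrix G F β *ᵥ fun p => x p.1 p.2) ⟨i, k⟩
      = (A i *ᵥ x i) k + b i k * protocol G F β x i := by
  have h1 : ∀ j, (G.laplacian i j) = (if i = j then ∑ l, G.weight i l else 0) - G.weight i j := by
    intro j
    simp [WeightedGraph.laplacian, Matrix.diagonal_apply]
  have h2 : ∀ j, ∑ l, (β j ᵥ* (F j).T) l * x j l = β j ⬝ᵥ ((F j).T *ᵥ x j) := fun j =>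
    (Matrix.dotProduct_mulVec (β j) (F j).T (x j)).symm
  have h3 : ∑ l, ((F i).alpha ᵥ* (F i).T) l * x i l = (F i).alpha ⬝ᵥ ((F i).T *ᵥ x i) :=
    (Matrix.dotProduct_mulVec (F i).alpha (F i).T (x i)).symm
  have h4 : (Matrix.blockDiagonal'
      (fun i => A i - Matrix.vecMulVec (b i) ((F i).alpha ᵥ* (F i).T)) *ᵥ
        fun p : Σ i, Fin (m i) => x p.1 p.2) ⟨i, k⟩
      = (A i *ᵥ x i) k - b i k * ((F i).alpha ⬝ᵥ ((F i).T *ᵥ x i)) := by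
    rw [← h3, Matrix.mulVec, dotProduct, Fintype.sum_sigma, Finset.sum_eq_single i]
    · simp [Matrix.mulVec, dotProduct, Matrix.vecMulVec_apply, sub_mul, Finset.sum_sub_distrib,
        Finset.mul_sum, mul_assoc]
    · intro j _ hj
      exact Finset.sum_eq_zero fun l _ => by
        rw [Matrix.blockDiagonal'_apply_ne _ _ _ (Ne.symm hj), zero_mul]
    · simp
  have h5 : ((Matrix.of fun p q : Σ i, Fin (m i) =>
      b p.1 p.2 * G.laplacian p.1 q.1 * (β q.1 ᵥ* (F q.1).T) q.2) *ᵥ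
        fun p : Σ i, Fin (m i) => x p.1 p.2) ⟨i, k⟩
      = b i k * ∑ j, G.laplacian i j * (β j ⬝ᵥ ((F j).T *ᵥ x j)) := by
    rw [Matrix.mulVec, dotProduct, Fintype.sum_sigma, Finset.mul_sum]
    refine Finset.sum_congr rfl fun j _ => ?_
    rw [← h2, Finset.mul_sum, Finset.mul_sum]
    exact Finset.sum_congr rfl fun l _ => by simp only [Matrix.of_apply]; ring
  rw [networkMatrix, Matrix.sub_mulVec, Pi.sub_apply, h4, h5, protocol]
  simp only [h1, sub_mul, mul_sub, Finset.sum_sub_distrib, ite_mul, zero_mul, Finset.sum_ite_eq,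
    Finset.mem_univ, if_true, Finset.sum_mul]
  ring

/-- The network is `Ξ`-uncontrollable: for suitable feedback gains `β_1, …, β_n` the closed-loop
network, driven by the external inputs of the leaders, is a `Ξ`-uncontrollable linear system. -/
def NetworkIsEigUncontrollable (G : WeightedGraph n) (leaders : Finset (Fin n))
    (F : ∀ i, ControllabilityForm (A i) (b i)) {σ : Type*}
    (Ξ : σ → (Σ i, Fin (m i)) → ℂ) : Prop :=
  ∃ β : ∀ i, Fin (m i) → ℝ,
    IsEigUncontrollable (networkMatrix G F β) (networkInput b leaders) Ξ

end Network

end HeteroNet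

/-!
The *outputs* `c_i = θ_iᵀ b_i` of a left eigenvector `θ` of the network decide everything. If they
all vanish, the coupling and the local feedback disappear from the eigenvector equation, and each
block `θ_i` is zero or an uncontrollable left eigenvector of `(A_i, b_i)`; conversely each
`ξ_ij ⊗ e_i` is a left eigenvector of the network for any choice of gains.

If some component contains no leader, the rows of the matrices `T_i` in which the inputs act form a
left null vector of the network, supported on that component, whose outputs there are equal to one.
It is orthogonal to all inputs and not in the span of the `ξ_ij ⊗ e_i`
(`isLeaderFollowerConnected_of_networkIsEigUncontrollable`).

If every component contains a leader, take the gains `β_i = κ_i e_first`. Then the eigenvector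
equation with eigenvalue `μ` gives `μ ^ r_i * c_i + κ_i * (L c)_i = 0`
(`ControllabilityForm.pow_mul_output_add_eq_zero`), with `c = 0` on the leaders. Positive `κ_i` such
that this forces `c = 0` are found agent by agent (`WeightedGraph.exists_gains`). For `μ = 0` the
minimum principle for `L` suffices. For `μ ≠ 0`, let `S` be a set of agents that contains the
leaders and admits no nonzero solution supported on `S`, and let `v` be a neighbour of `S`. With
`c_v` left free, the equations on `S` have no nonzero solution at `μ = 1`, by the minimum principle,
hence one exists for finitely many `μ` only. Each of these determines `c` up to scaling, and the
equation at `v` then holds for at most one value of `κ_v`, so that almost every `κ_v > 0` allows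
adding `v` to `S` (`WeightedGraph.exists_gain_insert`).

A controllability decomposition comes from the minimal polynomial `p` of `b` with respect to `A`:
the vectors `(p / X ^ (k + 1))(A) b` span the controllable subspace, and `A` acts on them as a
companion matrix (`nonempty_controllabilityForm`).
-/

namespace HeteroNet

open Matrix Polynomial

/-! ### Polynomial matrices that are injective at one point -/

/-- A constant left inverse `P` of `N(μ₀)` makes `det (P N)` a nonzero polynomial, and it vanishes
wherever `N(μ)` has a kernel. -/
theorem finite_setOf_eval_not_injective {ι κ : Type*} [Fintype ι] [Fintype κ]
    [DecidableEq ι] [DecidableEq κ] (N : Matrix ι κ ℂ[X]) (μ₀ : ℂ)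
    (h : ∀ c : κ → ℂ, N.map (eval μ₀) *ᵥ c = 0 → c = 0) :
    {μ : ℂ | ∃ c : κ → ℂ, c ≠ 0 ∧ N.map (eval μ) *ᵥ c = 0}.Finite := by
  obtain ⟨g, hg⟩ := LinearMap.exists_leftInverse_of_injective (N.map (eval μ₀)).mulVecLin
    (LinearMap.ker_eq_bot'.2 h)
  have hP : LinearMap.toMatrix' g * N.map (eval μ₀) = 1 := by
    have := congrArg LinearMap.toMatrix' hg
    rwa [LinearMap.toMatrix'_comp, LinearMap.toMatrix'_id, ← Matrix.toLin'_apply',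
      LinearMap.toMatrix'_toLin'] at this
  set P := LinearMap.toMatrix' g
  have hev : ∀ μ : ℂ, (P.map C * N).det.eval μ = (P * N.map (eval μ)).det := by
    intro μ
    rw [← coe_evalRingHom, RingHom.map_det, RingHom.mapMatrix_apply, Matrix.map_mul]
    congr 2
    ext i j
    simp
  have hD : (P.map C * N).det ≠ 0 := by
    intro h0
    have := hev μ₀
    rw [h0, hP] at this
    simp at this
  refine (Polynomial.finite_setOfPred_isRoot hD).subset ?_
  rintro μ ⟨c, hc, hNc⟩
  rw [Set.mem_ofPred_eq, IsRoot.def, hev]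
  exact Matrix.exists_mulVec_eq_zero_iff.1 ⟨c, hc, by rw [← Matrix.mulVec_mulVec, hNc, mulVec_zero]⟩

/-! ### Laplacian and minimum principle -/

namespace WeightedGraph

variable {n : ℕ}

/-- The Laplacian acting on functions with values in a real vector space,
`(L c)_i = ∑ j, a_ij (c_i - c_j)`. -/
def lap {E : Type*} [AddCommGroup E] [Module ℝ E] (G : WeightedGraph n) (c : Fin n → E)
    (i : Fin n) : E :=
  ∑ j, G.weight i j • (c i - c j)

theorem lap_map {E F : Type*} [AddCommGroup E] [Module ℝ E] [AddCommGroup F] [Module ℝ F]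
    (G : WeightedGraph n) (f : E →ₗ[ℝ] F) (c : Fin n → E) (i : Fin n) :
    f (G.lap c i) = G.lap (fun j => f (c j)) i := by
  simp [lap]

theorem lap_zero (G : WeightedGraph n) (i : Fin n) :
    G.lap (fun _ => (0 : ℂ)) i = 0 := by
  simp [lap]

theorem lap_sub {E : Type*} [AddCommGroup E] [Module ℝ E] (G : WeightedGraph n)
    (c d : Fin n → E) (i : Fin n) : G.lap (c - d) i = G.lap c i - G.lap d i := by
  simp only [lap, ← Finset.sum_sub_distrib, ← smul_sub, Pi.sub_apply]
  exact Finset.sum_congr rfl fun j _ => by congr 1; abel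

theorem lap_smul (G : WeightedGraph n) (a : ℂ) (c : Fin n → ℂ) (i : Fin n) :
    G.lap (a • c) i = a * G.lap c i := by
  simp only [lap, Finset.mul_sum, Pi.smul_apply, smul_eq_mul, Complex.real_smul]
  exact Finset.sum_congr rfl fun j _ => by ring

theorem sum_mul_laplacian (G : WeightedGraph n) (c : Fin n → ℂ) (i : Fin n) :
    ∑ j, c j * (G.laplacian j i : ℂ) = G.lap c i := by
  simp only [laplacian, Matrix.sub_apply, diagonal_apply, lap, Complex.ofReal_sub, mul_sub,
    Finset.sum_sub_distrib, smul_sub, Complex.real_smul]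
  congr 1
  · rw [Finset.sum_eq_single i (by intro j _ hj; rw [if_neg hj]; simp) (by simp), if_pos rfl,
      ← Finset.sum_mul, Complex.ofReal_sum, mul_comm]
  · exact Finset.sum_congr rfl fun j _ => by rw [G.symm j i, mul_comm]

/-- The set of agents `T` is closed under adjacency, i.e. it is a union of connected components. -/
def AdjClosed (G : WeightedGraph n) (T : Set (Fin n)) : Prop :=
  ∀ i ∈ T, ∀ j, 0 < G.weight i j → j ∈ T

theorem AdjClosed.mem_of_reachable {G : WeightedGraph n} {T : Set (Fin n)} (hT : G.AdjClosed T)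
    {i j : Fin n} (hij : G.toSimpleGraph.Reachable i j) (hi : i ∈ T) : j ∈ T := by
  obtain ⟨w⟩ := hij
  induction w with
  | nil => exact hi
  | cons h _ ih => exact ih (hT _ hi _ h)

theorem IsLeaderFollowerConnected.exists_reachable {G : WeightedGraph n} {leaders : Finset (Fin n)}
    (h : G.IsLeaderFollowerConnected leaders) (i : Fin n) :
    ∃ l ∈ leaders, G.toSimpleGraph.Reachable l i := by
  obtain ⟨l, hl, hli⟩ := h (G.toSimpleGraph.connectedComponentMk i)
  exact ⟨l, hl, SimpleGraph.ConnectedComponent.exact hli⟩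

/-- Minimum principle: if `c` is minimal at `i` and `(L c)_i ≥ 0`, then `c` is equal to `c i` at all
neighbours of `i`. -/
theorem eq_of_isMin_of_weight_pos {G : WeightedGraph n} {c : Fin n → ℝ} {i : Fin n}
    (hmin : ∀ j, c i ≤ c j) (h0 : 0 ≤ G.lap c i) {j : Fin n} (hj : 0 < G.weight i j) :
    c j = c i := by
  have hterm : ∀ k ∈ Finset.univ, 0 ≤ G.weight i k * (c k - c i) := fun k _ =>
    mul_nonneg (G.nonneg i k) (sub_nonneg.2 (hmin k))
  have hsum : ∑ k, G.weight i k * (c k - c i) = 0 := by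
    refine le_antisymm ?_ (Finset.sum_nonneg hterm)
    have : G.lap c i = -∑ k, G.weight i k * (c k - c i) := by
      rw [lap, ← Finset.sum_neg_distrib]
      exact Finset.sum_congr rfl fun k _ => by rw [smul_eq_mul]; ring
    linarith
  have := (Finset.sum_eq_zero_iff_of_nonneg hterm).1 hsum j (Finset.mem_univ j)
  rcases mul_eq_zero.1 this with h | h <;> linarith

/-- The set where `c` is minimal is closed under adjacency, so it contains a leader. -/
theorem nonneg_of_lap_eq_zero {G : WeightedGraph n} {leaders : Finset (Fin n)}
    (h : G.IsLeaderFollowerConnected leaders) {c : Fin n → ℝ} (hl : ∀ l ∈ leaders, c l = 0)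
    (hc : ∀ i, G.lap c i = 0) (i : Fin n) : 0 ≤ c i := by
  have : Nonempty (Fin n) := ⟨i⟩
  obtain ⟨k, hk⟩ := Finite.exists_min c
  have hcl : G.AdjClosed {j | c j = c k} := by
    intro p hp j hj
    have hp' : c p = c k := hp
    have := eq_of_isMin_of_weight_pos (fun q => hp' ▸ hk q) (hc p).ge hj
    exact this.trans hp'
  obtain ⟨l, hl', hlk⟩ := h.exists_reachable k
  have : c l = c k := hcl.mem_of_reachable hlk.symm rfl
  rw [← hl l hl', this]
  exact hk i

/-- The Laplacian grounded at the leaders is injective. This excludes the mode `μ = 0`. -/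
theorem eq_zero_of_lap_eq_zero {G : WeightedGraph n} {leaders : Finset (Fin n)}
    (h : G.IsLeaderFollowerConnected leaders) {c : Fin n → ℂ} (hl : ∀ l ∈ leaders, c l = 0)
    (hc : ∀ i, G.lap c i = 0) : c = 0 := by
  have key : ∀ f : ℂ →ₗ[ℝ] ℝ, ∀ i, 0 ≤ f (c i) := fun f =>
    nonneg_of_lap_eq_zero h (fun l hl' => by rw [hl l hl', map_zero])
      (fun i => by rw [← lap_map, hc, map_zero])
  have key' : ∀ f : ℂ →ₗ[ℝ] ℝ, ∀ i, f (c i) = 0 := fun f i =>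
    le_antisymm (by simpa using key (-f) i) (key f i)
  funext i
  exact Complex.ext (key' Complex.reLm i) (key' Complex.imLm i)

/-! ### Gains without hidden modes -/

/-- Every agent in `S` is reached from the leaders by a path whose vertices before the last one lie
in `S`, expressed without paths: a set that contains the leaders and is closed under passing from
its members in `S` to their neighbours contains `S`. -/
def IsReachedWithin (G : WeightedGraph n) (leaders S : Finset (Fin n)) : Prop :=
  ∀ T : Set (Fin n), (∀ l ∈ leaders, l ∈ T) →
    (∀ i ∈ S, i ∈ T → ∀ j, 0 < G.weight i j → j ∈ T) → ∀ i ∈ S, i ∈ T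

/-- If only the agents in `S` have nonzero outputs `c i`, then no nonzero `μ` admits a nonzero
solution of the mode equations `μ ^ r i * c i + κ i * (L c)_i = 0`, `i ∈ S`, that vanishes on the
leaders. -/
def HasNoHiddenMode (G : WeightedGraph n) (leaders : Finset (Fin n)) (r : Fin n → ℕ)
    (κ : Fin n → ℝ) (S : Finset (Fin n)) : Prop :=
  ∀ μ : ℂ, μ ≠ 0 → ∀ c : Fin n → ℂ, (∀ i ∉ S, c i = 0) → (∀ l ∈ leaders, c l = 0) →
    (∀ i ∈ S, μ ^ r i * c i + κ i * G.lap c i = 0) → c = 0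

/-- The mode equations at `μ = 1` on `S` alone, with an additional agent `v` next to `S` whose
output is free but nonnegative. By the minimum principle `c ≥ 0`, and its zero set spreads from the
leaders through `S` to `v`. -/
theorem eq_zero_at_boundary_of_nonneg {G : WeightedGraph n} {leaders S : Finset (Fin n)}
    {κ : Fin n → ℝ} (hκ : ∀ i, 0 < κ i) (hS : G.IsReachedWithin leaders S) {u v : Fin n}
    (hu : u ∈ S) (huv : 0 < G.weight u v) {c : Fin n → ℝ}
    (hout : ∀ i ∉ insert v S, c i = 0) (hl : ∀ l ∈ leaders, c l = 0)
    (heq : ∀ i ∈ S, c i + κ i * G.lap c i = 0) (hv : 0 ≤ c v) : c v = 0 := by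
  have : Nonempty (Fin n) := ⟨v⟩
  have hnn : ∀ i, 0 ≤ c i := by
    obtain ⟨k, hk⟩ := Finite.exists_min c
    suffices 0 ≤ c k from fun i => this.trans (hk i)
    by_contra! hneg
    have hkS : k ∈ S := by
      by_contra hkS
      by_cases hkv : k = v
      · rw [hkv] at hneg; exact absurd hv (not_le.2 hneg)
      · rw [hout k (by simp [hkv, hkS])] at hneg; exact lt_irrefl _ hneg
    have hle : G.lap c k ≤ 0 := Finset.sum_nonpos fun j _ =>
      mul_nonpos_of_nonneg_of_nonpos (G.nonneg k j) (sub_nonpos.2 (hk j))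
    have := mul_nonpos_of_nonneg_of_nonpos (hκ k).le hle
    linarith [heq k hkS]
  have hclosed : ∀ i ∈ S, c i = 0 → ∀ j, 0 < G.weight i j → c j = 0 := by
    intro i hi h0 j hj
    have h1 := heq i hi
    rw [h0, zero_add, mul_eq_zero] at h1
    rw [eq_of_isMin_of_weight_pos (fun j => h0 ▸ hnn j)
      (h1.resolve_left (hκ i).ne').ge hj, h0]
  exact hclosed u hu (hS {i | c i = 0} hl hclosed u hu) v huv

theorem eq_zero_at_boundary {G : WeightedGraph n} {leaders S : Finset (Fin n)}
    {κ : Fin n → ℝ} (hκ : ∀ i, 0 < κ i) (hS : G.IsReachedWithin leaders S) {u v : Fin n}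
    (hu : u ∈ S) (huv : 0 < G.weight u v) {c : Fin n → ℂ}
    (hout : ∀ i ∉ insert v S, c i = 0) (hl : ∀ l ∈ leaders, c l = 0)
    (heq : ∀ i ∈ S, c i + κ i * G.lap c i = 0) : c v = 0 := by
  have key : ∀ f : ℂ →ₗ[ℝ] ℝ, 0 ≤ f (c v) → f (c v) = 0 := fun f hf =>
    eq_zero_at_boundary_of_nonneg (c := fun i => f (c i)) hκ hS hu huv
      (fun i hi => by rw [hout i hi, map_zero]) (fun l hl' => by rw [hl l hl', map_zero])
      (fun i hi => by
        have := congrArg f (heq i hi)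
        rwa [map_add, ← Complex.real_smul, map_smul, lap_map, map_zero, smul_eq_mul] at this) hf
  have key' : ∀ f : ℂ →ₗ[ℝ] ℝ, f (c v) = 0 := by
    intro f
    rcases le_total 0 (f (c v)) with h | h
    · exact key f h
    · simpa using key (-f) (by simpa using h)
  exact Complex.ext (key' Complex.reLm) (key' Complex.imLm)

/-- With the output of `v` left free, the mode equations on `S` have a nonzero solution for finitely
many `μ` only: they depend polynomially on `μ` and are injective at `μ = 1`. -/
theorem finite_setOf_boundary_mode {G : WeightedGraph n} {leaders S : Finset (Fin n)}
    {κ : Fin n → ℝ} {r : Fin n → ℕ} (hκ : ∀ i, 0 < κ i) (hS : G.IsReachedWithin leaders S)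
    (hm : G.HasNoHiddenMode leaders r κ S) {u v : Fin n}
    (hu : u ∈ S) (huv : 0 < G.weight u v) :
    {μ : ℂ | ∃ c : Fin n → ℂ, c ≠ 0 ∧ (∀ i ∉ insert v S, c i = 0) ∧ (∀ l ∈ leaders, c l = 0) ∧
      ∀ i ∈ S, μ ^ r i * c i + κ i * G.lap c i = 0}.Finite := by
  classical
  -- The first block of rows encodes the vanishing outside `insert v S` and on the leaders, the
  -- second block the mode equations on `S`; rows that impose nothing are zero.
  let N : Matrix (Fin n ⊕ Fin n) (Fin n) ℂ[X] := Matrix.of fun p j =>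
    Sum.elim (fun i => if i ∉ insert v S ∨ i ∈ leaders then (if i = j then 1 else 0) else 0)
      (fun i => if i ∈ S then (if i = j then X ^ r i else 0) + C (κ i * (G.laplacian j i : ℂ))
        else 0) p
  have hN : ∀ (μ : ℂ) (c : Fin n → ℂ), N.map (eval μ) *ᵥ c = 0 ↔
      (∀ i ∉ insert v S, c i = 0) ∧ (∀ l ∈ leaders, c l = 0) ∧
        ∀ i ∈ S, μ ^ r i * c i + κ i * G.lap c i = 0 := by
    intro μ c
    have h1 : ∀ i, (N.map (eval μ) *ᵥ c) (Sum.inl i)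
        = if i ∉ insert v S ∨ i ∈ leaders then c i else 0 := by
      intro i
      by_cases h : i ∉ insert v S ∨ i ∈ leaders
      · simp only [mulVec, dotProduct, map_apply, N, of_apply, Sum.elim_inl, if_pos h]
        simp [apply_ite (eval μ)]
      · simp only [mulVec, dotProduct, map_apply, N, of_apply, Sum.elim_inl, if_neg h]
        simp
    have h2 : ∀ i, (N.map (eval μ) *ᵥ c) (Sum.inr i)
        = if i ∈ S then μ ^ r i * c i + κ i * G.lap c i else 0 := by
      intro i
      by_cases h : i ∈ S
      · simp only [mulVec, dotProduct, map_apply, N, of_apply, Sum.elim_inr, if_pos h]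
        simp only [eval_add, apply_ite (eval μ), eval_pow, eval_X, eval_zero, eval_C, add_mul,
          Finset.sum_add_distrib, ite_mul, zero_mul, Finset.sum_ite_eq, Finset.mem_univ, if_true]
        rw [← sum_mul_laplacian, Finset.mul_sum]
        congr 1
        exact Finset.sum_congr rfl fun j _ => by ring
      · simp only [mulVec, dotProduct, map_apply, N, of_apply, Sum.elim_inr, if_neg h]
        simp
    constructor
    · intro h0
      refine ⟨fun i hi => ?_, fun i hi => ?_, fun i hi => ?_⟩
      · have := h1 i
        rwa [h0, if_pos (Or.inl hi), eq_comm] at this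
      · have := h1 i
        rwa [h0, if_pos (Or.inr hi), eq_comm] at this
      · have := h2 i
        rwa [h0, if_pos hi, eq_comm] at this
    · rintro ⟨ha, hb, hc⟩
      funext p
      rcases p with i | i
      · rw [h1]
        split_ifs with h
        · exact h.elim (ha i) (hb i)
        · rfl
      · rw [h2]
        split_ifs with h
        · exact hc i h
        · rfl
  refine (finite_setOf_eval_not_injective N 1 ?_).subset ?_
  · intro c hc
    obtain ⟨ha, hb, he⟩ := (hN 1 c).1 hc
    have hv : c v = 0 := eq_zero_at_boundary hκ hS hu huv ha hb (by simpa using he)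
    refine hm 1 one_ne_zero c (fun i hi => ?_) hb he
    by_cases hiv : i = v
    · rw [hiv, hv]
    · exact ha i (by simp [hiv, hi])
  · rintro μ ⟨c, hc, h⟩
    exact ⟨c, hc, (hN μ c).2 h⟩

/-- An agent `v` next to `S` can be added to `S` with a suitable gain. Only finitely many `μ` can be
hidden modes of the enlarged set, and each of them excludes at most one value of the gain, since by
`hm` the solution normalized by `c v = 1` is unique. -/
theorem exists_gain_insert {G : WeightedGraph n} {leaders S : Finset (Fin n)}
    {κ : Fin n → ℝ} {r : Fin n → ℕ} (hκ : ∀ i, 0 < κ i) (hS : G.IsReachedWithin leaders S)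
    (hm : G.HasNoHiddenMode leaders r κ S) {u v : Fin n} (hv : v ∉ S)
    (hu : u ∈ S) (huv : 0 < G.weight u v) :
    ∃ ε : ℝ, 0 < ε ∧ G.HasNoHiddenMode leaders r (Function.update κ v ε) (insert v S) := by
  classical
  have hfin := finite_setOf_boundary_mode hκ hS hm hu huv
  let Z := {μ : ℂ | ∃ c : Fin n → ℂ, c ≠ 0 ∧ (∀ i ∉ insert v S, c i = 0) ∧
    (∀ l ∈ leaders, c l = 0) ∧ ∀ i ∈ S, μ ^ r i * c i + κ i * G.lap c i = 0}
  -- `bad μ` consists of the gains of `v` for which `μ` is a hidden mode with `c v ≠ 0`.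
  let bad : ℂ → Set ℝ := fun μ => {ε | μ ≠ 0 ∧ ∃ c : Fin n → ℂ, c v = 1 ∧
    (∀ i ∉ insert v S, c i = 0) ∧ (∀ l ∈ leaders, c l = 0) ∧
    (∀ i ∈ S, μ ^ r i * c i + κ i * G.lap c i = 0) ∧ μ ^ r v + ε * G.lap c v = 0}
  have hbad : ∀ μ, (bad μ).Subsingleton := by
    rintro μ ε ⟨hμ, c, hc1, hc2, hc3, hc4, hc5⟩ ε' ⟨-, d, hd1, hd2, hd3, hd4, hd5⟩
    have hcd : c - d = 0 := by
      refine hm μ hμ _ (fun i hi => ?_) (fun l hl => ?_) (fun i hi => ?_)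
      · by_cases hiv : i = v
        · simp [hiv, hc1, hd1]
        · simp [hc2 i (by simp [hiv, hi]), hd2 i (by simp [hiv, hi])]
      · simp [hc3 l hl, hd3 l hl]
      · rw [lap_sub, Pi.sub_apply]
        linear_combination hc4 i hi - hd4 i hi
    rw [← sub_eq_zero.1 hcd] at hd5
    have h1 : ((ε : ℂ) - ε') * G.lap c v = 0 := by linear_combination hc5 - hd5
    rcases mul_eq_zero.1 h1 with h | h
    · exact_mod_cast sub_eq_zero.1 h
    · rw [h, mul_zero, add_zero] at hc5
      exact absurd hc5 (pow_ne_zero _ hμ)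
  have hbadfin : (⋃ μ ∈ Z, bad μ).Finite := hfin.biUnion fun μ _ => (hbad μ).finite
  obtain ⟨ε, hε, hεb⟩ := (Set.Ioi_infinite (0 : ℝ)).exists_notMem_finite hbadfin
  refine ⟨ε, hε, fun μ hμ c hout hl heq => ?_⟩
  have heqS : ∀ i ∈ S, μ ^ r i * c i + κ i * G.lap c i = 0 := fun i hi => by
    have := heq i (Finset.mem_insert_of_mem hi)
    rwa [Function.update_of_ne (by rintro rfl; exact hv hi)] at this
  have heqv : μ ^ r v * c v + ε * G.lap c v = 0 := by
    simpa using heq v (Finset.mem_insert_self v S)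
  by_cases hcv : c v = 0
  · refine hm μ hμ c (fun i hi => ?_) hl heqS
    by_cases hiv : i = v
    · rw [hiv, hcv]
    · exact hout i (by simp [hiv, hi])
  · refine absurd (Set.mem_biUnion (x := μ) ?_ ?_) hεb
    · exact ⟨c, fun h => hcv (by rw [h]; rfl), hout, hl, heqS⟩
    · refine ⟨hμ, (c v)⁻¹ • c, by simp [hcv], fun i hi => by simp [hout i hi],
        fun l hl' => by simp [hl l hl'], fun i hi => ?_, ?_⟩
      · rw [lap_smul, Pi.smul_apply, smul_eq_mul]
        linear_combination (c v)⁻¹ * heqS i hi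
      · rw [lap_smul]
        have : (c v)⁻¹ * c v = 1 := inv_mul_cancel₀ hcv
        linear_combination (c v)⁻¹ * heqv - μ ^ r v * this

theorem exists_gains {G : WeightedGraph n} {leaders : Finset (Fin n)}
    (h : G.IsLeaderFollowerConnected leaders) {r : Fin n → ℕ} (hr : ∀ i, r i ≠ 0) :
    ∃ κ : Fin n → ℝ, ∀ (μ : ℂ) (c : Fin n → ℂ), (∀ l ∈ leaders, c l = 0) →
      (∀ i, μ ^ r i * c i + κ i * G.lap c i = 0) → c = 0 := by
  classical
  let good : Finset (Fin n) → Prop := fun S => leaders ⊆ S ∧ G.IsReachedWithin leaders S ∧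
    ∃ κ : Fin n → ℝ, (∀ i, 0 < κ i) ∧ G.HasNoHiddenMode leaders r κ S
  -- Enlarge the set of leaders as far as possible; a maximal `S` is closed under adjacency.
  have hbase : good leaders := by
    refine ⟨subset_rfl, fun T hT _ => hT, 1, fun _ => one_pos, fun μ _ c hout hl _ => ?_⟩
    funext i
    exact if hi : i ∈ leaders then hl i hi else hout i hi
  obtain ⟨S, hgood, hmax⟩ := Finset.exists_max_image (Finset.univ.filter good) Finset.card
    ⟨leaders, by simpa using hbase⟩
  obtain ⟨hlS, hreach, κ, hκ, hm⟩ := (Finset.mem_filter.1 hgood).2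
  have hclosed : G.AdjClosed (S : Set (Fin n)) := by
    intro u hu v huv
    by_contra hv
    obtain ⟨ε, hε, hm'⟩ := exists_gain_insert hκ hreach hm hv hu huv
    have hgood' : good (insert v S) := by
      refine ⟨hlS.trans (Finset.subset_insert v S), fun T hT hcl => ?_,
        Function.update κ v ε, fun i => ?_, hm'⟩
      · have hST := hreach T hT fun i hi => hcl i (Finset.mem_insert_of_mem hi)
        intro i hi
        rcases Finset.mem_insert.1 hi with rfl | hi
        · exact hcl u (Finset.mem_insert_of_mem hu) (hST u hu) _ huv
        · exact hST i hi
      · by_cases hiv : i = v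
        · subst hiv; simpa using hε
        · simpa [hiv] using hκ i
    have := hmax _ (Finset.mem_filter.2 ⟨Finset.mem_univ _, hgood'⟩)
    rw [Finset.card_insert_of_notMem (by simpa using hv)] at this
    omega
  have huniv : ∀ i, i ∈ S := fun i => by
    obtain ⟨l, hl, hli⟩ := h.exists_reachable i
    exact hclosed.mem_of_reachable hli (hlS hl)
  refine ⟨κ, fun μ c hl heq => ?_⟩
  by_cases hμ : μ = 0
  · refine eq_zero_of_lap_eq_zero h hl fun i => ?_
    have := heq i
    rw [hμ, zero_pow (hr i), zero_mul, zero_add, mul_eq_zero] at this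
    exact this.resolve_left (by exact_mod_cast (hκ i).ne')
  · exact hm μ hμ c (fun i hi => absurd (huniv i) hi) hl fun i _ => heq i

end WeightedGraph

/-! ### Existence of a controllability decomposition -/

theorem coeff_divX_iterate (p : ℝ[X]) (k j : ℕ) : (divX^[k] p).coeff j = p.coeff (j + k) := by
  induction k generalizing j with
  | zero => rfl
  | succ k ih => rw [Function.iterate_succ_apply', coeff_divX, ih]; congr 1; omega

/-- The minimal polynomial of the vector `b` with respect to `A`. -/
theorem exists_monic_minimal_annihilator {m : ℕ} (A : Matrix (Fin m) (Fin m) ℝ) (b : Fin m → ℝ) :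
    ∃ p : ℝ[X], p.Monic ∧ aeval A p *ᵥ b = 0 ∧
      ∀ q : ℝ[X], q.natDegree < p.natDegree → aeval A q *ᵥ b = 0 → q = 0 := by
  classical
  have hex : ∃ d : ℕ, ∃ p : ℝ[X], p.Monic ∧ aeval A p *ᵥ b = 0 ∧ p.natDegree = d :=
    ⟨_, A.charpoly, A.charpoly_monic, by rw [aeval_self_charpoly, zero_mulVec], rfl⟩
  obtain ⟨p, hp, hpb, hd⟩ := Nat.find_spec hex
  refine ⟨p, hp, hpb, fun q hq hqb => ?_⟩
  by_contra hq0
  refine Nat.find_min hex (m := q.natDegree) (hd ▸ hq)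
    ⟨q * C q.leadingCoeff⁻¹, monic_mul_leadingCoeff_inv hq0, ?_, ?_⟩
  · rw [mul_comm, map_mul, ← mulVec_mulVec, hqb, mulVec_zero]
  · exact natDegree_mul_C (inv_ne_zero (leadingCoeff_ne_zero.2 hq0))

theorem exists_linearIndependent_extension {r m : ℕ} {f : Fin r → Fin m → ℝ}
    (hf : LinearIndependent ℝ f) (hr : r ≤ m) :
    ∃ g : Fin m → Fin m → ℝ, LinearIndependent ℝ g ∧ ∀ k, g (Fin.castLE hr k) = f k := by
  classical
  let B := Module.Basis.sumExtend hf
  have : Finite (Fin r ⊕ Module.Basis.sumExtendIndex hf) := Module.Finite.finite_basis B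
  have : Finite (Module.Basis.sumExtendIndex hf) := Finite.sum_right (Fin r)
  have := Fintype.ofFinite (Module.Basis.sumExtendIndex hf)
  have hcard : r + Fintype.card (Module.Basis.sumExtendIndex hf) = m := by
    have := Module.finrank_eq_card_basis B
    simpa using this.symm
  let e : Fin r ⊕ Module.Basis.sumExtendIndex hf ≃ Fin m :=
    ((Equiv.refl _).sumCongr (Fintype.equivFin _)).trans (finSumFinEquiv.trans (finCongr hcard))
  refine ⟨B.reindex e, (B.reindex e).linearIndependent, fun k => ?_⟩
  have he : e.symm (Fin.castLE hr k) = Sum.inl k := by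
    rw [Equiv.symm_apply_eq]
    ext
    simp [e]
  rw [Module.Basis.reindex_apply, he]
  simp only [B, Module.Basis.sumExtend, Module.Basis.reindex_apply, Module.Basis.extend_apply_self]
  rfl

/-- A basis `g` in which `A` acts on the vectors up to `g last = b` as a backward shift modulo `b`
gives a controllability decomposition: `T⁻¹` has the columns `g l`. -/
theorem nonempty_controllabilityForm_of_chain {m : ℕ} {A : Matrix (Fin m) (Fin m) ℝ}
    {b : Fin m → ℝ} {g : Fin m → Fin m → ℝ} (hg : LinearIndependent ℝ g) (last : Fin m)
    (hlast : g last = b) (a : Fin m → ℝ)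
    (h0 : ∀ l : Fin m, (l : ℕ) = 0 → A *ᵥ g l = a l • b)
    (hsucc : ∀ l k : Fin m, l ≤ last → (l : ℕ) = k + 1 → A *ᵥ g l = g k + a l • b) :
    Nonempty (ControllabilityForm A b) := by
  let P : Matrix (Fin m) (Fin m) ℝ := Matrix.of fun i l => g l i
  have hP : IsUnit P := Matrix.linearIndependent_cols_iff_isUnit.1 hg
  have hdet : IsUnit P.det := (Matrix.isUnit_iff_isUnit_det P).1 hP
  have hcol : ∀ l, P⁻¹ *ᵥ g l = Pi.single l 1 := by
    intro l
    have : P *ᵥ Pi.single l 1 = g l := by rw [mulVec_single_one]; rfl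
    rw [← this, mulVec_mulVec, nonsing_inv_mul _ hdet, one_mulVec]
  have hentry : ∀ k l, (P⁻¹ * A * (P⁻¹)⁻¹) k l = (P⁻¹ *ᵥ (A *ᵥ g l)) k := by
    intro k l
    rw [nonsing_inv_nonsing_inv _ hdet, mulVec_mulVec]
    rfl
  have hform : ∀ k l : Fin m, k ≠ last → l ≤ last →
      (P⁻¹ * A * (P⁻¹)⁻¹) k l = if (l : ℕ) = k + 1 then 1 else 0 := by
    intro k l hk hl
    rw [hentry]
    rcases Nat.eq_zero_or_eq_succ_pred (l : ℕ) with hl0 | hl1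
    · rw [h0 l hl0, mulVec_smul, ← hlast, hcol, if_neg (by omega)]
      simp [hk]
    · have hlt : (l : ℕ) - 1 < m := by omega
      rw [hsucc l ⟨l - 1, hlt⟩ hl hl1, mulVec_add, mulVec_smul, ← hlast, hcol, hcol]
      simp only [Pi.add_apply, Pi.smul_apply, Pi.single_apply, hk, if_false, smul_zero, add_zero,
        Fin.ext_iff]
      congr 1
      apply propext
      simp only [Nat.pred_eq_sub_one, Nat.succ_eq_add_one] at hl1
      omega
  refine ⟨⟨P⁻¹, ?_, last, ?_, fun k l hk hl => hform k l hk.ne hl, fun k l hk hl => ?_⟩⟩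
  · rw [det_nonsing_inv]
    exact hdet.ringInverse
  · rw [← hlast, hcol]
  · rw [hform k l hk.ne' hl, if_neg]
    have := Fin.lt_def.1 hk
    have := Fin.le_def.1 hl
    omega

/-- The quotients of `p` by `X, X ^ 2, …` have distinct degrees, all below that of `p`, so a linear
relation would give a nonzero polynomial of smaller degree annihilating `b`. -/
theorem linearIndependent_aeval_divX {m : ℕ} {A : Matrix (Fin m) (Fin m) ℝ} {b : Fin m → ℝ}
    {p : ℝ[X]} (hp : p.Monic)
    (hmin : ∀ q : ℝ[X], q.natDegree < p.natDegree → aeval A q *ᵥ b = 0 → q = 0) :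
    LinearIndependent ℝ fun k : Fin p.natDegree => aeval A (divX^[k + 1] p) *ᵥ b := by
  rw [Fintype.linearIndependent_iff]
  intro c hc
  have hcoeff : ∀ j, (∑ k : Fin p.natDegree, c k • divX^[k + 1] p).coeff j
      = ∑ k : Fin p.natDegree, c k * p.coeff (j + (k + 1)) := by
    intro j
    simp only [finsetSum_coeff, coeff_smul, smul_eq_mul, coeff_divX_iterate]
  have hQ : ∑ k : Fin p.natDegree, c k • divX^[k + 1] p = 0 := by
    rcases Nat.eq_zero_or_pos p.natDegree with h0 | hpos
    · have : IsEmpty (Fin p.natDegree) := by rw [h0]; infer_instance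
      simp
    refine hmin _ ?_ ?_
    · refine (Nat.lt_iff_le_pred hpos).2 (natDegree_le_iff_coeff_eq_zero.2 fun j hj => ?_)
      rw [hcoeff]
      exact Finset.sum_eq_zero fun k _ => by
        rw [coeff_eq_zero_of_natDegree_lt (by omega), mul_zero]
    · rw [map_sum, sum_mulVec]
      simpa only [map_smul, smul_mulVec] using hc
  -- The coefficients `c k * p.coeff (j + (k + 1))` form a triangular system: at `j = deg p - 1 - k`
  -- only the indices up to `k` occur, and `c k` has coefficient one.
  suffices ∀ k : ℕ, ∀ hk : k < p.natDegree, c ⟨k, hk⟩ = 0 from fun k => this k k.2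
  intro k
  induction k using Nat.strong_induction_on with
  | _ k ih =>
    intro hk
    have h := hcoeff (p.natDegree - 1 - k)
    rw [hQ, coeff_zero, Finset.sum_eq_single ⟨k, hk⟩, show p.natDegree - 1 - k + (k + 1)
      = p.natDegree by omega, hp.coeff_natDegree, mul_one] at h
    · exact h.symm
    · intro l _ hl
      rcases lt_or_gt_of_ne (fun h : (l : ℕ) = k => hl (Fin.ext h)) with hlk | hlk
      · rw [ih l hlk l.2, zero_mul]
      · rw [coeff_eq_zero_of_natDegree_lt (by omega), mul_zero]
    · simp

/-- With `p` the minimal polynomial of `b`, the vectors `(p / X ^ (k + 1))(A) b`, where the division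
discards the remainder, satisfy the shift relations by Horner's scheme. -/
theorem nonempty_controllabilityForm {m : ℕ} (A : Matrix (Fin m) (Fin m) ℝ) {b : Fin m → ℝ}
    (hb : b ≠ 0) : Nonempty (ControllabilityForm A b) := by
  obtain ⟨p, hp, hpb, hmin⟩ := exists_monic_minimal_annihilator A b
  have hf := linearIndependent_aeval_divX hp hmin
  have hpos : 0 < p.natDegree := by
    rw [Nat.pos_iff_ne_zero]
    intro h0
    rw [hp.natDegree_eq_zero.1 h0, map_one, one_mulVec] at hpb
    exact hb hpb
  have hr : p.natDegree ≤ m := by simpa using hf.fintype_card_le_finrank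
  obtain ⟨g, hg, hgf⟩ := exists_linearIndependent_extension hf hr
  have hgk : ∀ k : Fin m, (k : ℕ) < p.natDegree → g k = aeval A (divX^[k + 1] p) *ᵥ b :=
    fun k hk => hgf ⟨k, hk⟩
  have hstep : ∀ k : ℕ, A *ᵥ (aeval A (divX^[k + 1] p) *ᵥ b)
      = aeval A (divX^[k] p) *ᵥ b - p.coeff k • b := by
    intro k
    have h := congrArg (fun q => aeval A q *ᵥ b) (divX_mul_X_add (divX^[k] p))
    simp only [coeff_divX_iterate, zero_add, mul_comm _ X, map_add, map_mul, aeval_X, aeval_C,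
      add_mulVec, ← mulVec_mulVec, Algebra.algebraMap_eq_smul_one, smul_mulVec, one_mulVec] at h
    rw [← h, Function.iterate_succ_apply']
    simp
  refine nonempty_controllabilityForm_of_chain hg ⟨p.natDegree - 1, by omega⟩ ?_
    (fun l => -p.coeff l) ?_ ?_
  · rw [hgk _ (by simp; omega)]
    have : divX^[p.natDegree - 1 + 1] p = 1 := by
      ext j
      rw [coeff_divX_iterate, coeff_one]
      split_ifs with h
      · rw [h, show 0 + (p.natDegree - 1 + 1) = p.natDegree by omega, hp.coeff_natDegree]
      · exact coeff_eq_zero_of_natDegree_lt (by omega)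
    rw [this, map_one, one_mulVec]
  · intro l hl
    rw [hgk l (by omega), hstep, hl, Function.iterate_zero_apply, hpb, zero_sub, neg_smul]
  · intro l k hl hlk
    have := Fin.le_def.1 hl
    simp only at this
    rw [hgk l (by omega), hgk k (by omega), hstep, hlk, neg_smul, sub_eq_add_neg]

/-! ### The feedback of a single agent -/

section Agent

variable {m : ℕ} {A : Matrix (Fin m) (Fin m) ℝ} {b : Fin m → ℝ}

theorem isOrthogonalTo_inputColumn_iff {ξ : Fin m → ℂ} :
    IsOrthogonalTo (inputColumn b) ξ ↔ ∑ k, ξ k * (b k : ℂ) = 0 := by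
  constructor
  · intro h
    exact congrFun h ()
  · intro h
    funext _
    exact h

namespace ControllabilityForm

/-- The first controllable coordinate. -/
def first (F : ControllabilityForm A b) : Fin m := ⟨0, F.last.pos⟩

/-- Block `i` of the eigenvector equation of the network, with gain `β = κ e_first`. In the
coordinates of the decomposition the controllable columns form a chain, and eliminating all its
entries except the output `θᵀ b` leaves one scalar equation. -/
theorem pow_mul_output_add_eq_zero (F : ControllabilityForm A b) {θ : Fin m → ℂ} {d μ : ℂ} {κ : ℝ}
    (h : ∀ k, (θ ᵥ* A.map (fun r : ℝ => (r : ℂ))) k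
      - (∑ l, θ l * (b l : ℂ)) * ((F.alpha ᵥ* F.T) k : ℝ)
      - d * ((Pi.single F.first κ ᵥ* F.T) k : ℝ) = μ * θ k) :
    μ ^ ((F.last : ℕ) + 1) * (∑ l, θ l * (b l : ℂ)) + κ * d = 0 := by
  let φ : ℝ →+* ℂ := Complex.ofRealHom
  set c : ℂ := ∑ l, θ l * (b l : ℂ) with hc
  set η : Fin m → ℂ := θ ᵥ* F.T⁻¹.map φ with hη
  set H := F.T * A * F.T⁻¹ with hH
  have hTT : F.T.map φ * F.T⁻¹.map φ = 1 := by
    rw [← Matrix.map_mul, mul_nonsing_inv _ F.isUnit_det]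
    simp
  have hTT' : F.T⁻¹.map φ * F.T.map φ = 1 := by
    rw [← Matrix.map_mul, nonsing_inv_mul _ F.isUnit_det]
    simp
  have hvec : ∀ v : Fin m → ℝ, (fun k => (((v ᵥ* F.T) k : ℝ) : ℂ)) ᵥ* F.T⁻¹.map φ
      = fun k => (v k : ℂ) := by
    intro v
    have : (fun k => (((v ᵥ* F.T) k : ℝ) : ℂ)) = (fun k => (v k : ℂ)) ᵥ* F.T.map φ := by
      funext k
      exact RingHom.map_vecMul φ F.T v k
    rw [this, vecMul_vecMul, hTT, vecMul_one]
  have hclast : c = η F.last := by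
    have hbT : b = F.T⁻¹ *ᵥ Pi.single F.last 1 := by
      rw [← F.input_eq, mulVec_mulVec, nonsing_inv_mul _ F.isUnit_det, one_mulVec]
    have hbl : ∀ l, b l = F.T⁻¹ l F.last := fun l => by
      conv_lhs => rw [hbT, mulVec_single_one]
      rfl
    rw [hc, hη]
    exact Finset.sum_congr rfl fun l _ => by rw [hbl l]; rfl
  have heq : ∀ l, (η ᵥ* H.map φ) l - c * F.alpha l - d * (Pi.single F.first κ : Fin m → ℝ) l
      = μ * η l := by
    have hv : θ ᵥ* A.map φ - c • (fun k => (((F.alpha ᵥ* F.T) k : ℝ) : ℂ))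
        - d • (fun k => (((Pi.single F.first κ ᵥ* F.T) k : ℝ) : ℂ)) = μ • θ := funext h
    have hv' := congrArg (· ᵥ* F.T⁻¹.map φ) hv
    simp only [sub_vecMul, smul_vecMul, hvec] at hv'
    have hHη : η ᵥ* H.map φ = θ ᵥ* A.map φ ᵥ* F.T⁻¹.map φ := by
      rw [hη, hH, Matrix.map_mul, Matrix.map_mul, vecMul_vecMul, vecMul_vecMul, ← Matrix.mul_assoc,
        ← Matrix.mul_assoc, hTT', Matrix.one_mul]
    intro l
    have := congrFun hv' l
    rwa [← hHη] at this
  -- The controllable columns of `T A T⁻¹`, up to the last row, which the feedback cancels.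
  have hcol : ∀ l, l ≤ F.last → (η ᵥ* H.map φ) l
      = c * F.alpha l + ∑ k : Fin m, if (l : ℕ) = k + 1 then η k else 0 := by
    intro l hl
    have hl' := Fin.le_def.1 hl
    have hterm : ∀ k, η k * (H.map φ) k l
        = (if k = F.last then c * F.alpha l else 0) + if (l : ℕ) = k + 1 then η k else 0 := by
      intro k
      rcases lt_trichotomy k F.last with hk | hk | hk
      · rw [map_apply, hH, F.shift_eq k l hk hl, if_neg hk.ne, zero_add]
        split_ifs <;> simp
      · rw [hk, if_pos rfl, if_neg (by omega), add_zero, hclast]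
        rfl
      · have := Fin.lt_def.1 hk
        rw [map_apply, hH, F.lower_eq k l hk hl, if_neg hk.ne', if_neg (by omega)]
        simp
    simp only [vecMul, dotProduct, hterm, Finset.sum_add_distrib, Finset.sum_ite_eq',
      Finset.mem_univ, if_true]
  have hzero : μ * η F.first = -(κ * d) := by
    rw [← heq, hcol F.first (Fin.le_def.2 (Nat.zero_le _)), Finset.sum_eq_zero, Pi.single_eq_same]
    · ring
    · intro k _
      rw [if_neg]
      simp [first]
  have hpow : ∀ (j : ℕ) (hj : j ≤ (F.last : ℕ)),
      μ ^ j * η ⟨j, lt_of_le_of_lt hj F.last.2⟩ = η F.first := by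
    intro j
    induction j with
    | zero => intro _; rw [pow_zero, one_mul]; rfl
    | succ j ih =>
      intro hj
      rw [← ih (by omega), pow_succ, mul_assoc, ← heq, hcol _ (Fin.le_def.2 hj),
        Pi.single_eq_of_ne (by simp [first]),
        Finset.sum_eq_single ⟨j, by omega⟩ (fun k _ hk => if_neg fun h => hk (Fin.ext ?_))
          (by simp)]
      · simp
      · simp only at h
        simp only
        omega
  rw [hclast, pow_succ', mul_assoc, hpow F.last le_rfl, hzero]
  ring

theorem last_row_mul (F : ControllabilityForm A b) (k : Fin m) :
    (F.T F.last ᵥ* A) k = (F.alpha ᵥ* F.T) k := by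
  have : F.T * A = F.T * A * F.T⁻¹ * F.T := by
    rw [Matrix.mul_assoc _ F.T⁻¹, nonsing_inv_mul _ F.isUnit_det, Matrix.mul_one]
  exact congrFun (congrFun this F.last) k

theorem last_row_dotProduct (F : ControllabilityForm A b) : F.T F.last ⬝ᵥ b = 1 := by
  have := congrFun F.input_eq F.last
  rwa [Pi.single_eq_same] at this

end ControllabilityForm

end Agent

/-! ### Left eigenvectors of the network -/

section Network

variable {n : ℕ} {m : Fin n → ℕ} {A : ∀ i, Matrix (Fin (m i)) (Fin (m i)) ℝ}
  {b : ∀ i, Fin (m i) → ℝ}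

/-- The output `θ_iᵀ b_i` of the stacked vector `θ` at agent `i`. -/
def outputs (b : ∀ i, Fin (m i) → ℝ) (i : Fin n) : ((Σ i, Fin (m i)) → ℂ) →ₗ[ℂ] ℂ :=
  ∑ k, (b i k : ℂ) • LinearMap.proj ⟨i, k⟩

theorem outputs_apply (i : Fin n) (θ : (Σ i, Fin (m i)) → ℂ) :
    outputs b i θ = ∑ k, θ ⟨i, k⟩ * (b i k : ℂ) := by
  simp [outputs, mul_comm]

/-- `blockVec i` as a linear map. -/
def blockVecLin (i : Fin n) : (Fin (m i) → ℂ) →ₗ[ℂ] (Σ k, Fin (m k)) → ℂ :=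
  (LinearEquiv.piCurry ℂ fun i (_ : Fin (m i)) => ℂ).symm.toLinearMap ∘ₗ
    LinearMap.single ℂ (fun i => Fin (m i) → ℂ) i

theorem blockVec_same {R : Type*} [Zero R] (i : Fin n) (v : Fin (m i) → R) (k : Fin (m i)) :
    blockVec i v ⟨i, k⟩ = v k := by simp [blockVec]

theorem blockVec_ne {R : Type*} [Zero R] {i j : Fin n} (v : Fin (m i) → R) (h : j ≠ i)
    (k : Fin (m j)) : blockVec i v ⟨j, k⟩ = 0 := by simp [blockVec, h]

theorem sum_blockVec (θ : (Σ i, Fin (m i)) → ℂ) :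
    ∑ i, blockVec i (fun k => θ ⟨i, k⟩) = θ := by
  funext ⟨j, k⟩
  rw [Finset.sum_apply, Finset.sum_eq_single j (fun i _ hi => blockVec_ne _ hi.symm k) (by simp),
    blockVec_same]

theorem isOrthogonalTo_networkInput_iff {leaders : Finset (Fin n)} {θ : (Σ i, Fin (m i)) → ℂ} :
    IsOrthogonalTo (networkInput b leaders) θ ↔ ∀ l ∈ leaders, outputs b l θ = 0 := by
  have h : ∀ l : {l // l ∈ leaders},
      (θ ᵥ* (networkInput b leaders).map (fun r : ℝ => (r : ℂ))) l = outputs b l θ := by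
    intro l
    rw [outputs_apply, vecMul, dotProduct, Fintype.sum_sigma, Finset.sum_eq_single l.1]
    · exact Finset.sum_congr rfl fun k _ => by simp [networkInput, blockVec_same]
    · intro j _ hj
      exact Finset.sum_eq_zero fun k _ => by simp [networkInput, blockVec_ne _ hj]
    · simp
  constructor
  · intro h0 l hl
    rw [← h ⟨l, hl⟩, h0]
    rfl
  · intro h0
    funext l
    rw [h l, h0 l l.2]
    rfl

/-- The blocks of `θᵀ` times the network matrix. Block `i` depends on the
other blocks of `θ` only through the outputs. -/
theorem vecMul_networkMatrix (G : WeightedGraph n) (F : ∀ i, ControllabilityForm (A i) (b i))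
    (β : ∀ i, Fin (m i) → ℝ) (θ : (Σ i, Fin (m i)) → ℂ) (i : Fin n) (k : Fin (m i)) :
    (θ ᵥ* (networkMatrix G F β).map (fun r : ℝ => (r : ℂ))) ⟨i, k⟩
      = ((fun l => θ ⟨i, l⟩) ᵥ* (A i).map (fun r : ℝ => (r : ℂ))) k
        - outputs b i θ * (((F i).alpha ᵥ* (F i).T) k : ℝ)
        - G.lap (fun j => outputs b j θ) i * ((β i ᵥ* (F i).T) k : ℝ) := by
  rw [← G.sum_mul_laplacian]
  simp only [outputs_apply, vecMul, dotProduct]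
  rw [Fintype.sum_sigma]
  simp only [networkMatrix, map_apply, Matrix.sub_apply, Complex.ofReal_sub, mul_sub,
    Finset.sum_sub_distrib]
  congr 1
  · rw [Finset.sum_eq_single i]
    · simp only [blockDiagonal'_apply_eq, Matrix.sub_apply, vecMulVec_apply, Complex.ofReal_sub,
        mul_sub, Finset.sum_sub_distrib, Finset.sum_mul]
      congr 1
      exact Finset.sum_congr rfl fun l _ => by simp [vecMul, dotProduct, mul_assoc]
    · intro j _ hj
      exact Finset.sum_eq_zero fun l _ => by simp [blockDiagonal'_apply_ne _ _ _ hj]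
    · simp
  · rw [Finset.sum_mul]
    refine Finset.sum_congr rfl fun j _ => ?_
    rw [Finset.sum_mul, Finset.sum_mul]
    refine Finset.sum_congr rfl fun l _ => ?_
    simp only [of_apply, Complex.ofReal_mul, vecMul, dotProduct]
    ring

theorem linearIndependent_blockVec {s : Fin n → ℕ} {ξ : ∀ i, Fin (s i) → Fin (m i) → ℂ}
    (h : ∀ i, LinearIndependent ℂ (ξ i)) :
    LinearIndependent ℂ fun p : Σ i, Fin (s i) => blockVec p.1 (ξ p.1 p.2) :=
  LinearIndependent.map'
    (v := fun p : Σ i, Fin (s i) => (Pi.single p.1 (ξ p.1 p.2) : ∀ i, Fin (m i) → ℂ))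
    (Pi.linearIndependent_single (R := ℂ) ξ h)
    (LinearEquiv.piCurry ℂ fun i (_ : Fin (m i)) => ℂ).symm.toLinearMap (LinearEquiv.ker _)

theorem outputs_blockVec_eq_zero {i : Fin n} {v : Fin (m i) → ℂ}
    (h : IsOrthogonalTo (inputColumn (b i)) v) (j : Fin n) : outputs b j (blockVec i v) = 0 := by
  rw [outputs_apply]
  by_cases hij : j = i
  · subst hij
    simpa only [blockVec_same] using isOrthogonalTo_inputColumn_iff.1 h
  · exact Finset.sum_eq_zero fun k _ => by rw [blockVec_ne _ hij, zero_mul]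

theorem isLeftEigenvector_blockVec (G : WeightedGraph n)
    (F : ∀ i, ControllabilityForm (A i) (b i)) (β : ∀ i, Fin (m i) → ℝ) {i : Fin n}
    {v : Fin (m i) → ℂ} (hv : IsLeftEigenvector (A i) v)
    (h : IsOrthogonalTo (inputColumn (b i)) v) :
    IsLeftEigenvector (networkMatrix G F β) (blockVec i v) := by
  obtain ⟨hv0, μ, hμ⟩ := hv
  refine ⟨fun h0 => hv0 (funext fun k => ?_), μ, funext fun ⟨j, k⟩ => ?_⟩
  · rw [← blockVec_same i v k, h0]
    rfl
  · rw [vecMul_networkMatrix]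
    simp only [outputs_blockVec_eq_zero h, G.lap_zero, zero_mul, sub_zero, Pi.smul_apply]
    by_cases hij : j = i
    · subst hij
      simp only [blockVec_same]
      exact congrFun hμ k
    · simp only [blockVec_ne v hij, smul_zero]
      exact congrFun (zero_vecMul _) k

/-- On a component without leaders, the last controllable rows of the matrices `T_i` together form a
left null vector of the network; its outputs there are equal to one, whereas those of the
`ξ_ij ⊗ e_i` vanish. -/
theorem isLeaderFollowerConnected_of_networkIsEigUncontrollable {s : Fin n → ℕ}
    {ξ : ∀ i, Fin (s i) → Fin (m i) → ℂ}
    (hξ : ∀ i, IsEigUncontrollable (A i) (inputColumn (b i)) (ξ i))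
    {G : WeightedGraph n} {leaders : Finset (Fin n)} {F : ∀ i, ControllabilityForm (A i) (b i)}
    (h : NetworkIsEigUncontrollable G leaders F
      (fun p : Σ i, Fin (s i) => blockVec p.1 (ξ p.1 p.2))) :
    G.IsLeaderFollowerConnected leaders := by
  classical
  obtain ⟨β, hβ⟩ := h
  intro C
  by_contra! hC
  let χ : Fin n → ℂ := fun i => if G.toSimpleGraph.connectedComponentMk i = C then 1 else 0
  let θ : (Σ i, Fin (m i)) → ℂ := fun p => χ p.1 * ((F p.1).T (F p.1).last p.2 : ℝ)
  have hout : ∀ i, outputs b i θ = χ i := by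
    intro i
    have := congrArg (fun r : ℝ => (r : ℂ)) (F i).last_row_dotProduct
    simp only [dotProduct, Complex.ofReal_sum, Complex.ofReal_mul, Complex.ofReal_one] at this
    simp only [outputs_apply, θ, mul_assoc, ← Finset.mul_sum, this, mul_one]
  have hlap : ∀ i, G.lap χ i = 0 := by
    intro i
    refine Finset.sum_eq_zero fun j _ => ?_
    rcases (G.nonneg i j).eq_or_lt with h0 | hpos
    · rw [← h0, zero_smul]
    · have hij : G.toSimpleGraph.Adj i j := hpos
      have : χ i = χ j := by
        simp only [χ, SimpleGraph.ConnectedComponent.sound hij.reachable]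
      rw [this, sub_self, smul_zero]
  have hmul : θ ᵥ* (networkMatrix G F β).map (fun r : ℝ => (r : ℂ)) = 0 := by
    funext ⟨i, k⟩
    rw [vecMul_networkMatrix]
    simp only [hout, hlap, zero_mul, sub_zero, ← (F i).last_row_mul]
    simp only [vecMul, dotProduct, map_apply, Complex.ofReal_sum, Complex.ofReal_mul, θ, mul_assoc,
      Finset.mul_sum, sub_self, Pi.zero_apply]
  obtain ⟨i, rfl⟩ := C.exists_rep
  have hi : outputs b i θ = 1 := by rw [hout]; exact if_pos rfl
  have hspan := hβ.mem_span θ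
    ⟨fun h0 => by rw [h0, map_zero] at hi; exact zero_ne_one hi, 0, by rw [hmul, zero_smul]⟩
    (isOrthogonalTo_networkInput_iff.2 fun l hl => by rw [hout]; exact if_neg (hC l hl))
  have hker : Submodule.span ℂ (Set.range fun p : Σ i, Fin (s i) => blockVec p.1 (ξ p.1 p.2))
      ≤ LinearMap.ker (outputs b i) := by
    rw [Submodule.span_le]
    rintro _ ⟨p, rfl⟩
    exact outputs_blockVec_eq_zero ((hξ p.1).isOrthogonalTo p.2) i
  rw [LinearMap.mem_ker.1 (hker hspan)] at hi
  exact zero_ne_one hi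

/-- The gains of `exists_gains` force the outputs of an uncontrollable left eigenvector to vanish,
and then its blocks are zero or uncontrollable left eigenvectors of the agents. -/
theorem networkIsEigUncontrollable_of_isLeaderFollowerConnected {s : Fin n → ℕ}
    {ξ : ∀ i, Fin (s i) → Fin (m i) → ℂ}
    (hξ : ∀ i, IsEigUncontrollable (A i) (inputColumn (b i)) (ξ i))
    {G : WeightedGraph n} {leaders : Finset (Fin n)} (F : ∀ i, ControllabilityForm (A i) (b i))
    (h : G.IsLeaderFollowerConnected leaders) :
    NetworkIsEigUncontrollable G leaders F
      (fun p : Σ i, Fin (s i) => blockVec p.1 (ξ p.1 p.2)) := by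
  obtain ⟨κ, hκ⟩ := WeightedGraph.exists_gains h (r := fun i => ((F i).last : ℕ) + 1)
    (fun i => Nat.succ_ne_zero _)
  refine ⟨fun i => Pi.single (F i).first (κ i),
    linearIndependent_blockVec fun i => (hξ i).linearIndependent,
    fun p => isLeftEigenvector_blockVec G F _ ((hξ p.1).isLeftEigenvector p.2)
      ((hξ p.1).isOrthogonalTo p.2),
    fun p => isOrthogonalTo_networkInput_iff.2 fun l _ =>
      outputs_blockVec_eq_zero ((hξ p.1).isOrthogonalTo p.2) l, ?_⟩
  rintro θ ⟨-, μ, hμ⟩ horth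
  have hblock : ∀ i k, _ := fun i k =>
    (vecMul_networkMatrix G F (fun i => Pi.single (F i).first (κ i)) θ i k).symm.trans
      (congrFun hμ ⟨i, k⟩)
  have hzero : (fun i => outputs b i θ) = 0 := by
    refine hκ μ _ (isOrthogonalTo_networkInput_iff.1 horth) fun i => ?_
    have := (F i).pow_mul_output_add_eq_zero (θ := fun k => θ ⟨i, k⟩)
      (d := G.lap (fun j => outputs b j θ) i) (μ := μ) (κ := κ i)
      (by simpa only [outputs_apply, Pi.smul_apply, smul_eq_mul] using hblock i)
    simpa only [outputs_apply] using this
  have hout : ∀ i, outputs b i θ = 0 := congrFun hzero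
  rw [← sum_blockVec θ]
  refine Submodule.sum_mem _ fun i _ => ?_
  have hmem : (fun k => θ ⟨i, k⟩) ∈ Submodule.span ℂ (Set.range (ξ i)) := by
    by_cases h0 : (fun k => θ ⟨i, k⟩) = 0
    · rw [h0]
      exact zero_mem _
    · refine (hξ i).mem_span _ ⟨h0, μ, funext fun k => ?_⟩
        (isOrthogonalTo_inputColumn_iff.2 (by rw [← outputs_apply]; exact hout i))
      have := hblock i k
      simpa only [hout, G.lap_zero, zero_mul, sub_zero, Pi.smul_apply] using this
  have hle : Submodule.span ℂ (Set.range (ξ i)) ≤ (Submodule.span ℂ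
      (Set.range fun p : Σ i, Fin (s i) => blockVec p.1 (ξ p.1 p.2))).comap (blockVecLin i) := by
    rw [Submodule.span_le]
    rintro _ ⟨j, rfl⟩
    exact Submodule.subset_span ⟨⟨i, j⟩, rfl⟩
  exact hle hmem

end Network

end HeteroNet

theorem mainTheorem8 {n : ℕ} {m s : Fin n → ℕ}
    (A : ∀ i, Matrix (Fin (m i)) (Fin (m i)) ℝ) (b : ∀ i, Fin (m i) → ℝ)
    (hb : ∀ i, b i ≠ 0)
    (ξ : ∀ i, Fin (s i) → Fin (m i) → ℂ)
    (hξ : ∀ i, HeteroNet.IsEigUncontrollable (A i) (HeteroNet.inputColumn (b i)) (ξ i))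
    (G : HeteroNet.WeightedGraph n) (leaders : Finset (Fin n)) :
    (∀ i, Nonempty (HeteroNet.ControllabilityForm (A i) (b i))) ∧
      ∀ F : ∀ i, HeteroNet.ControllabilityForm (A i) (b i),
        HeteroNet.NetworkIsEigUncontrollable G leaders F
            (fun p : Σ i, Fin (s i) => HeteroNet.blockVec p.1 (ξ p.1 p.2))
          ↔ G.IsLeaderFollowerConnected leaders :=
  ⟨fun i => HeteroNet.nonempty_controllabilityForm (A i) (hb i), fun F =>
    ⟨HeteroNet.isLeaderFollowerConnected_of_networkIsEigUncontrollable hξ,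
      HeteroNet.networkIsEigUncontrollable_of_isLeaderFollowerConnected hξ F⟩⟩
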